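/- Let $D\ge 0$ be an integer, and let $\Omega\subset\mathbb{R}^D$ be a domain, i.e. a bounded connected (non-empty) open set. Write $\|f\|=(\int_\Omega |f|^2\,\mathrm{d}V)^{1/2}$ for the $L^2$ norm over $\Omega$ of a scalar or vector field. For $\nu>0$, $\lambda\ge 0$, $t_0\in\mathbb{R}$, $t_0<T\le\infty$ and a body force $\mathbf{g}$, the GePUP-E formulation of the incompressible Navier–Stokes equations on $[t_0,T)\times\Omega$, with unknowns $\mathbf{w},\mathbf{u}$ (vector fields) and $q$ (a scalar field), is \begin{align*} \partial_t\mathbf{w} &= \mathbf{g}-\mathbf{u}\cdot\nabla\mathbf{u}-\nabla q+\nu\Delta\mathbf{w} && \text{in }\Omega,\\ \mathbf{w}\cdot\boldsymbol{\tau}&=0,\quad \nabla\cdot\mathbf{w}=0 && \text{on }\partial\Omega,\\ \mathbf{u}&=\mathscr{P}\mathbf{w} && \text{in }\Omega,\\ \mathbf{u}\cdot\mathbf{n}&=0 && \text{on }\partial\Omega,\\ \Delta q&=\nabla\cdot(\mathbf{g}-\mathbf{u}\cdot\nabla\mathbf{u}) && \text{in }\Omega,\\ \mathbf{n}\cdot\nabla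 q&=\mathbf{n}\cdot(\mathbf{g}-\mathbf{u}\cdot\nabla\mathbf{u}+\nu\Delta\mathbf{w})+\lambda\,\mathbf{n}\cdot\mathbf{w} && \text{on }\partial\Omega. \end{align*} Here $\mathscr{P}$ is the Leray–Helmholtz projection: $\mathbf{u}=\mathscr{P}\mathbf{w}$ means that $\mathbf{w}=\mathbf{u}+\nabla\psi$ in $\Omega$ for some scalar $\psi\in C^1(\Omega)$, with $\nabla\cdot\mathbf{u}=0$ in $\Omega$ and $\mathbf{u}\cdot\mathbf{n}=0$ on $\partial\Omega$. Boundary values are limits from inside $\Omega$; the conditions that involve the unit outward normal $\mathbf{n}$ or a tangent vector $\boldsymbol{\tau}\perp\mathbf{n}$ are imposed at each boundary point near which $\partial\Omega$ is $C^1$, and $\nabla\cdot\mathbf{w}=0$ at each boundary point. At $t_0$ time derivatives are one-sided. A classical solution is a triple $(\mathbf{w},\mathbf{u},q)$ that satisfies these equations for all $t\in[t_0,T)$ and for which: the spatial derivatives of $\mathbf{w}$ of order $\le 3$ and those of $\partial_t\mathbf{w}$ of order $\le 1$ exist and extend continuously to $[t_0,T)\times\overline{\Omega}$; and, for each $t$,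 $\mathbf{u}(t),q(t)\in C^2(\Omega)$ and $\mathbf{g}(t)\in C^1(\Omega)$. Theorem. There is a constant $C>0$, depending only on $\Omega$, such that for all $\nu>0$, $\lambda\ge0$, $t_0<T\le\infty$, every $\mathbf{g}$ and every classical solution $(\mathbf{w},\mathbf{u},q)$ of the GePUP-E formulation on $[t_0,T)\times\Omega$ (no initial condition relating $\mathbf{w}$ to $\mathbf{u}$ is imposed), the following holds for all $t\in[t_0,T)$. 1. $\nabla\cdot\mathbf{w}(t)\in C^2(\Omega)$, and $\nabla\cdot\mathbf{w}$ satisfies the heat equation $$\frac{\partial(\nabla\cdot\mathbf{w})}{\partial t}=\nu\Delta(\nabla\cdot\mathbf{w})\quad\text{in }\Omega,\qquad \nabla\cdot\mathbf{w}=0\quad\text{on }\partial\Omega .$$ 2. $\nabla\cdot\mathbf{w}(t)$ and $\nabla(\nabla\cdot\mathbf{w}(t))$ are square integrable over $\Omega$, $\|\nabla\cdot\mathbf{w}\|^2$ is differentiable in time at $t$, and $$\frac{\mathrm{d}}{\mathrm{d}t}\|\nabla\cdot\mathbf{w}\|^2=-2\nu\,\|\nabla(\nabla\cdot\mathbf{w})\|^2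 .$$ 3. $$\|\nabla\cdot\mathbf{w}(t)\|\le e^{-\nu C(t-t_0)}\,\|\nabla\cdot\mathbf{w}(t_0)\| .$$ -/

import Mathlib

open Set Filter Topology MeasureTheory

noncomputable section

namespace GePUP

/-- The Euclidean space of dimension `D`. -/
abbrev Space (D : ℕ) : Type := EuclideanSpace ℝ (Fin D)

/-- The divergence of a vector field, `∑ i, ∂ v_i / ∂ x_i`. -/
def divergence {D : ℕ} (v : Space D → Space D) (x : Space D) : ℝ :=
  ∑ i : Fin D, (fderiv ℝ v x (EuclideanSpace.single i 1)) i

/-- The convection term `(u · ∇) u`, whose `i`-th component is `∑ j, u_j ∂ u_i / ∂ x_j`. -/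
def convection {D : ℕ} (u : Space D → Space D) (x : Space D) : Space D :=
  fderiv ℝ u x (u x)

/-- The `L²` norm over `Ω` of a scalar- or vector-valued function. -/
def l2Norm {D : ℕ} {F : Type*} [NormedAddCommGroup F] (Ω : Set (Space D)) (f : Space D → F) : ℝ :=
  Real.sqrt (∫ x in Ω, ‖f x‖ ^ 2)

/-- The time interval `[t₀, T)`; `T = ⊤` gives `[t₀, ∞)`. -/
def timeInterval (t₀ : ℝ) (T : EReal) : Set ℝ :=
  {t : ℝ | t₀ ≤ t ∧ (t : EReal) < T}

/-- `n` is the unit outward normal of `∂Ω` at the boundary point `x`: near `x`, the set `Ω` is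
the sublevel set `{ρ < 0}` of a `C¹` function `ρ` with `∇ρ(x) ≠ 0`, and `n = ∇ρ(x) / |∇ρ(x)|`.
Boundary points at which `∂Ω` is not `C¹` have no normal. -/
def IsOutwardUnitNormal {D : ℕ} (Ω : Set (Space D)) (x n : Space D) : Prop :=
  x ∈ frontier Ω ∧
    ∃ ρ : Space D → ℝ, ContDiffAt ℝ 1 ρ x ∧ (∀ᶠ y in 𝓝 x, (y ∈ Ω ↔ ρ y < 0)) ∧
      gradient ρ x ≠ 0 ∧ n = ‖gradient ρ x‖⁻¹ • gradient ρ x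

/-- `f` has the boundary value `a` at `x ∈ ∂Ω`, as the limit from inside `Ω`. -/
def HasBoundaryValue {D : ℕ} {F : Type*} [TopologicalSpace F] (Ω : Set (Space D))
    (f : Space D → F) (x : Space D) (a : F) : Prop :=
  Tendsto f (𝓝[Ω] x) (𝓝 a)

/-- The time-dependent field `f`, given on `J × Ω`, extends continuously to
`J × closure Ω`. -/
def ContinuousUpToBoundary {D : ℕ} {F : Type*} [TopologicalSpace F] (J : Set ℝ)
    (Ω : Set (Space D)) (f : ℝ → Space D → F) : Prop :=
  ∃ fbar : ℝ × Space D → F, ContinuousOn fbar (J ×ˢ closure Ω) ∧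
    ∀ t ∈ J, ∀ x ∈ Ω, fbar (t, x) = f t x

/-- The time-dependent field `f` has spatial derivatives up to order `k` in `Ω`, all of which are
continuous in `(t, x)` up to the boundary of `Ω`. -/
def SpatiallyC {D : ℕ} {F : Type*} [NormedAddCommGroup F] [NormedSpace ℝ F] (k : ℕ) (J : Set ℝ)
    (Ω : Set (Space D)) (f : ℝ → Space D → F) : Prop :=
  (∀ t ∈ J, ContDiffOn ℝ k (f t) Ω) ∧
    ∀ m : ℕ, m ≤ k → ContinuousUpToBoundary J Ω (fun t x => iteratedFDeriv ℝ m (f t) x)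

/-- The partial time derivative on the time interval `J`, one-sided at an end point in `J`. -/
def timeDeriv {D : ℕ} (J : Set ℝ) (w : ℝ → Space D → Space D) (t : ℝ) (x : Space D) : Space D :=
  derivWithin (fun s => w s x) J t

/-- `v` is the Leray-Helmholtz projection of `vstar`: `vstar = v + ∇ψ` in `Ω` with `v` of zero
divergence in `Ω` and of zero normal component on `∂Ω`. -/
def IsLerayProjection {D : ℕ} (Ω : Set (Space D)) (vstar v : Space D → Space D) : Prop :=
  (∃ ψ : Space D → ℝ, ContDiffOn ℝ 1 ψ Ω ∧ ∀ x ∈ Ω, vstar x = v x + gradient ψ x) ∧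
    (∀ x ∈ Ω, divergence v x = 0) ∧
    ∀ x n : Space D, IsOutwardUnitNormal Ω x n → HasBoundaryValue Ω (fun y => inner ℝ (v y) n) x 0

/-- `(w, u, q)` is a classical solution on `J × Ω` of the GePUP-E formulation with body force `g`,
viscosity `ν` and penalty parameter `lam`. -/
structure IsGePUPESolution {D : ℕ} (Ω : Set (Space D)) (J : Set ℝ) (ν lam : ℝ)
    (g w u : ℝ → Space D → Space D) (q : ℝ → Space D → ℝ) : Prop where
  /-- `w` is `C³` in space, up to the boundary. -/
  w_reg : SpatiallyC 3 J Ω w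
  /-- `w` is differentiable in time. -/
  w_time : ∀ x ∈ Ω, DifferentiableOn ℝ (fun s => w s x) J
  /-- `∂w/∂t` is `C¹` in space, up to the boundary. -/
  w_time_reg : SpatiallyC 1 J Ω (timeDeriv J w)
  u_reg : ∀ t ∈ J, ContDiffOn ℝ 2 (u t) Ω
  q_reg : ∀ t ∈ J, ContDiffOn ℝ 2 (q t) Ω
  g_reg : ∀ t ∈ J, ContDiffOn ℝ 1 (g t) Ω
  /-- `∂w/∂t = g - u·∇u - ∇q + ν Δw` in `Ω`. -/
  momentum : ∀ t ∈ J, ∀ x ∈ Ω,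
    timeDeriv J w t x =
      g t x - convection (u t) x - gradient (q t) x + ν • Laplacian.laplacian (w t) x
  /-- `w·τ = 0` on `∂Ω` for each tangent vector `τ`. -/
  tangential : ∀ t ∈ J, ∀ x n τ : Space D, IsOutwardUnitNormal Ω x n → inner ℝ τ n = 0 →
    HasBoundaryValue Ω (fun y => inner ℝ (w t y) τ) x 0
  /-- `∇·w = 0` on `∂Ω`. -/
  div_boundary : ∀ t ∈ J, ∀ x ∈ frontier Ω, HasBoundaryValue Ω (divergence (w t)) x 0
  /-- `u = 𝒫 w` in `Ω`. -/
  projection : ∀ t ∈ J, IsLerayProjection Ω (w t) (u t)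
  /-- `u·n = 0` on `∂Ω`. -/
  u_normal : ∀ t ∈ J, ∀ x n : Space D, IsOutwardUnitNormal Ω x n →
    HasBoundaryValue Ω (fun y => inner ℝ (u t y) n) x 0
  /-- `Δq = ∇·(g - u·∇u)` in `Ω`. -/
  pressure : ∀ t ∈ J, ∀ x ∈ Ω,
    Laplacian.laplacian (q t) x = divergence (fun y => g t y - convection (u t) y) x
  /-- `n·∇q = n·(g - u·∇u + ν Δw) + lam n·w` on `∂Ω`. -/
  pressure_boundary : ∀ t ∈ J, ∀ x n : Space D, IsOutwardUnitNormal Ω x n →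
    HasBoundaryValue Ω
      (fun y => inner ℝ n (gradient (q t) y) -
        (inner ℝ n (g t y - convection (u t) y + ν • Laplacian.laplacian (w t) y) +
          lam * inner ℝ n (w t y))) x 0

end GePUP

end

/-! Write v = ∇·w. In the divergence of the momentum equation, the pressure equation cancels ∇q
against g − u·∇u. Since the divergence commutes with Δ and with ∂/∂t, what remains is ∂v/∂t = νΔv
(`IsGePUPESolution.divergence_timeDeriv`, `IsGePUPESolution.hasDerivWithinAt_divergence`).
Multiplying by 2v, integrating over Ω and applying Green's identity gives the energy law. The
Poincaré inequality bounds its right-hand side by a multiple of -‖v‖², and Grönwall's inequality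
gives the decay.

The delicate point is that ∂Ω is arbitrary, so no surface integrals or traces are available; only
the limit v → 0 at ∂Ω can be used. For a C¹ function φ_ε that vanishes on [-ε, ε], the function
φ_ε(v) is supported in {|v| ≥ ε}, which is a compact subset of Ω. Products containing φ_ε(v)
therefore extend by zero to the whole space, and their derivatives integrate to zero
(`setIntegral_fderiv_eq_zero`). Green's identity (`setIntegral_mul_laplacian`) and the Poincaré
inequality (`setIntegral_sq_le_gradient`) follow as ε → 0. The limit in Green's identity also needs
∇v = 0 almost everywhere on {v = 0}.

Time derivatives are taken on compact intervals [t₀, b], where continuity up to the boundary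
supplies the uniform bounds for dominated convergence. -/

noncomputable section

namespace GePUP

/-! ### Coordinate identities for divergence, gradient and Laplacian -/

/-- The trace functional in coordinates, so that `divergence v x = divCLM D (fderiv ℝ v x)`. -/
def divCLM (D : ℕ) : (Space D →L[ℝ] Space D) →L[ℝ] ℝ :=
  ∑ i : Fin D, (EuclideanSpace.proj i : Space D →L[ℝ] ℝ).comp
    (ContinuousLinearMap.apply ℝ (Space D) (EuclideanSpace.single i (1 : ℝ)))

theorem divergence_eq_divCLM {D : ℕ} (v : Space D → Space D) :
    divergence v = fun x => divCLM D (fderiv ℝ v x) := by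
  funext x
  simp [divergence, divCLM]

theorem ContDiffOn.divergence {D : ℕ} {n m : ℕ} {Ω : Set (Space D)} {v : Space D → Space D}
    (hopen : IsOpen Ω) (hv : ContDiffOn ℝ n v Ω) (hmn : m + 1 ≤ n) :
    ContDiffOn ℝ m (GePUP.divergence v) Ω := by
  rw [divergence_eq_divCLM]
  exact (divCLM D).contDiff.comp_contDiffOn
    (hv.fderiv_of_isOpen hopen (by exact_mod_cast hmn))

section Laplacian

variable {D : ℕ} {F : Type*} [NormedAddCommGroup F] [NormedSpace ℝ F]

theorem fderiv_fderiv_apply_const {f : Space D → F} {x : Space D} (hf : ContDiffAt ℝ 2 f x)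
    (a b : Space D) :
    fderiv ℝ (fun y => fderiv ℝ f y a) x b = fderiv ℝ (fderiv ℝ f) x b a := by
  have h : DifferentiableAt ℝ (fderiv ℝ f) x :=
    (hf.fderiv_right (m := 1) (by norm_num)).differentiableAt (by norm_num)
  have := ((ContinuousLinearMap.apply ℝ F a).hasFDerivAt.comp x h.hasFDerivAt).fderiv
  exact congrArg (fun L => L b) this

theorem fderiv_fderiv_comm {f : Space D → F} {x : Space D} (hf : ContDiffAt ℝ 2 f x)
    (a b : Space D) :
    fderiv ℝ (fun y => fderiv ℝ f y a) x b = fderiv ℝ (fun y => fderiv ℝ f y b) x a := by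
  rw [fderiv_fderiv_apply_const hf, fderiv_fderiv_apply_const hf]
  exact (hf.isSymmSndFDerivAt (by simp)).eq _ _

theorem laplacian_eq_sum {f : Space D → F} {x : Space D} (hf : ContDiffAt ℝ 2 f x) :
    Laplacian.laplacian f x = ∑ j : Fin D,
      fderiv ℝ (fun y => fderiv ℝ f y (EuclideanSpace.single j 1)) x
        (EuclideanSpace.single j 1) := by
  rw [InnerProductSpace.laplacian_eq_iteratedFDeriv_orthonormalBasis f
    (EuclideanSpace.basisFun (Fin D) ℝ)]
  refine Finset.sum_congr rfl fun j _ => ?_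
  rw [fderiv_fderiv_apply_const hf]
  simp [iteratedFDeriv_two_apply]

theorem contDiffOn_fderiv_apply {f : Space D → F} {Ω : Set (Space D)} (hopen : IsOpen Ω)
    {m n : ℕ} (hf : ContDiffOn ℝ n f Ω) (hmn : m + 1 ≤ n) (a : Space D) :
    ContDiffOn ℝ m (fun y => fderiv ℝ f y a) Ω :=
  (hf.fderiv_of_isOpen hopen (by exact_mod_cast hmn)).clm_apply contDiffOn_const

/-- In each direction `e` this is the symmetry of third derivatives: `e` is moved past the two
derivatives ∂ⱼ∂ⱼ one at a time, by two applications of the symmetry of second derivatives. -/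
theorem fderiv_laplacian {f : Space D → F} {Ω : Set (Space D)} (hopen : IsOpen Ω)
    (hf : ContDiffOn ℝ 3 f Ω) {x : Space D} (hx : x ∈ Ω) :
    fderiv ℝ (Laplacian.laplacian f) x = Laplacian.laplacian (fderiv ℝ f) x := by
  have hnhds : ∀ y ∈ Ω, Ω ∈ 𝓝 y := fun y hy => hopen.mem_nhds hy
  have hf2 : ∀ y ∈ Ω, ContDiffAt ℝ 2 f y := fun y hy =>
    (hf.contDiffAt (hnhds y hy)).of_le (by norm_num)
  have hd : ∀ a, ContDiffOn ℝ 2 (fun y => fderiv ℝ f y a) Ω := fun a =>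
    contDiffOn_fderiv_apply (m := 2) (n := 3) hopen hf (by norm_num) a
  have hdd : ∀ a b, ContDiffOn ℝ 1 (fun z => fderiv ℝ (fun y => fderiv ℝ f y a) z b) Ω :=
    fun a b => contDiffOn_fderiv_apply (m := 1) (n := 2) hopen (hd a) (by norm_num) b
  have hD : ContDiffAt ℝ 2 (fderiv ℝ f) x :=
    (hf.fderiv_of_isOpen hopen (by norm_num : (2 : WithTop ℕ∞) + 1 ≤ 3)).contDiffAt (hnhds x hx)
  ext e
  have h1 : Laplacian.laplacian (fderiv ℝ f) x e =
      Laplacian.laplacian (fun y => fderiv ℝ f y e) x :=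
    (hD.laplacian_CLM_comp_left (l := ContinuousLinearMap.apply ℝ F e)).symm
  rw [h1, laplacian_eq_sum ((hd e).contDiffAt (hnhds x hx))]
  have h2 : Laplacian.laplacian f =ᶠ[𝓝 x] fun z => ∑ j : Fin D,
      fderiv ℝ (fun y => fderiv ℝ f y (EuclideanSpace.single j 1)) z
        (EuclideanSpace.single j 1) := by
    filter_upwards [hnhds x hx] with z hz using laplacian_eq_sum (hf2 z hz)
  rw [h2.fderiv_eq, fderiv_fun_sum fun j _ =>
    ((hdd _ _).contDiffAt (hnhds x hx)).differentiableAt (by norm_num),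
    sum_apply]
  refine Finset.sum_congr rfl fun j _ => ?_
  rw [fderiv_fderiv_comm ((hd _).contDiffAt (hnhds x hx))]
  have h3 : (fun z => fderiv ℝ (fun y => fderiv ℝ f y (EuclideanSpace.single j 1)) z e) =ᶠ[𝓝 x]
      fun z => fderiv ℝ (fun y => fderiv ℝ f y e) z (EuclideanSpace.single j 1) := by
    filter_upwards [hnhds x hx] with z hz using fderiv_fderiv_comm (hf2 z hz) _ _
  rw [h3.fderiv_eq]

theorem contDiffOn_laplacian {f : Space D → F} {Ω : Set (Space D)} (hopen : IsOpen Ω)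
    (hf : ContDiffOn ℝ 3 f Ω) : ContDiffOn ℝ 1 (Laplacian.laplacian f) Ω := by
  refine ContDiffOn.congr (ContDiffOn.sum (s := Finset.univ) fun (j : Fin D) _ =>
    contDiffOn_fderiv_apply (m := 1) (n := 2) hopen (contDiffOn_fderiv_apply (m := 2) (n := 3)
      hopen hf (by norm_num) (EuclideanSpace.single j 1)) (by norm_num)
      (EuclideanSpace.single j 1)) fun z hz => ?_
  exact laplacian_eq_sum ((hf.contDiffAt (hopen.mem_nhds hz)).of_le (by norm_num))

end Laplacian

theorem divergence_laplacian {D : ℕ} {v : Space D → Space D} {Ω : Set (Space D)}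
    (hopen : IsOpen Ω) (hv : ContDiffOn ℝ 3 v Ω) {x : Space D} (hx : x ∈ Ω) :
    divergence (Laplacian.laplacian v) x = Laplacian.laplacian (divergence v) x := by
  have hD : ContDiffAt ℝ 2 (fderiv ℝ v) x :=
    (hv.fderiv_of_isOpen hopen (by norm_num : (2 : WithTop ℕ∞) + 1 ≤ 3)).contDiffAt
      (hopen.mem_nhds hx)
  rw [divergence_eq_divCLM (Laplacian.laplacian v), divergence_eq_divCLM v]
  simp only [fderiv_laplacian hopen hv hx]
  exact (hD.laplacian_CLM_comp_left (l := divCLM D)).symm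

theorem gradient_apply {D : ℕ} (f : Space D → ℝ) (x : Space D) (i : Fin D) :
    gradient f x i = fderiv ℝ f x (EuclideanSpace.single i 1) := by
  rw [← InnerProductSpace.toDual_symm_apply (𝕜 := ℝ), EuclideanSpace.inner_single_right]
  simp [gradient]

theorem norm_gradient {D : ℕ} (f : Space D → ℝ) (x : Space D) :
    ‖gradient f x‖ = ‖fderiv ℝ f x‖ := by
  simp [gradient]

theorem norm_gradient_sq {D : ℕ} (f : Space D → ℝ) (x : Space D) :
    ‖gradient f x‖ ^ 2 = ∑ i : Fin D, (fderiv ℝ f x (EuclideanSpace.single i 1)) ^ 2 := by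
  simp [EuclideanSpace.norm_sq_eq, gradient_apply]

theorem contDiffOn_gradient {D : ℕ} {f : Space D → ℝ} {Ω : Set (Space D)} (hopen : IsOpen Ω)
    (hf : ContDiffOn ℝ 2 f Ω) : ContDiffOn ℝ 1 (gradient f) Ω :=
  (InnerProductSpace.toDual ℝ (Space D)).symm.toContinuousLinearEquiv.contDiff.comp_contDiffOn
    (hf.fderiv_of_isOpen hopen (by norm_num))

theorem divergence_gradient {D : ℕ} {f : Space D → ℝ} {Ω : Set (Space D)} (hopen : IsOpen Ω)
    (hf : ContDiffOn ℝ 2 f Ω) {x : Space D} (hx : x ∈ Ω) :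
    divergence (gradient f) x = Laplacian.laplacian f x := by
  rw [laplacian_eq_sum (hf.contDiffAt (hopen.mem_nhds hx)), divergence]
  refine Finset.sum_congr rfl fun i _ => ?_
  have hg : DifferentiableAt ℝ (gradient f) x :=
    ((contDiffOn_gradient hopen hf).contDiffAt (hopen.mem_nhds hx)).differentiableAt (by norm_num)
  have := ((EuclideanSpace.proj i : Space D →L[ℝ] ℝ).hasFDerivAt.comp x hg.hasFDerivAt).fderiv
  have h2 : (EuclideanSpace.proj i : Space D →L[ℝ] ℝ) ∘ gradient f =
      fun y => fderiv ℝ f y (EuclideanSpace.single i 1) := by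
    funext y
    simp [gradient_apply]
  rw [← h2, this]
  simp

theorem contDiffOn_convection {D : ℕ} {u : Space D → Space D} {Ω : Set (Space D)}
    (hopen : IsOpen Ω) (hu : ContDiffOn ℝ 2 u Ω) : ContDiffOn ℝ 1 (convection u) Ω :=
  (hu.fderiv_of_isOpen hopen (by norm_num)).clm_apply (hu.of_le (by norm_num))

/-! ### Exchange of time and space derivatives -/

/-- Differentiation in time commutes with the spatial derivative. -/
theorem hasDerivWithinAt_fderiv {D : ℕ} {F : Type*} [NormedAddCommGroup F] [NormedSpace ℝ F]
    [CompleteSpace F] {Ω : Set (Space D)} (hopen : IsOpen Ω) {a b : ℝ} (hab : a ≤ b)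
    {f f' : ℝ → Space D → F}
    (hf : ∀ s ∈ Icc a b, ∀ x ∈ Ω, HasDerivWithinAt (fun r => f r x) (f' s x) (Icc a b) s)
    (hfd : ∀ s ∈ Icc a b, DifferentiableOn ℝ (f s) Ω)
    (hf'c : ∀ x ∈ Ω, ContinuousOn (fun s => f' s x) (Icc a b))
    (hf'd : ∀ s ∈ Icc a b, DifferentiableOn ℝ (f' s) Ω)
    (hDc : ∀ x ∈ Ω, ContinuousOn (fun s => fderiv ℝ (f' s) x) (Icc a b)) {M : ℝ}
    (hM : ∀ s ∈ Icc a b, ∀ x ∈ Ω, ‖fderiv ℝ (f' s) x‖ ≤ M)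
    {x : Space D} (hx : x ∈ Ω) {t : ℝ} (ht : t ∈ Icc a b) :
    HasDerivWithinAt (fun s => fderiv ℝ (f s) x) (fderiv ℝ (f' t) x) (Icc a b) t := by
  have hΩ : Ω ∈ 𝓝 x := hopen.mem_nhds hx
  have hsub : ∀ s ∈ Icc a b, uIcc a s ⊆ Icc a b := fun s hs => by
    rw [uIcc_of_le hs.1]
    exact Icc_subset_Icc_right hs.2
  have hsub' : ∀ s ∈ Icc a b, uIoc a s ⊆ Icc a b := fun s hs =>
    uIoc_subset_uIcc.trans (hsub s hs)
  -- The equation is integrated in time, differentiated in space under the integral sign, and then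
  -- differentiated in time again.
  have key : ∀ s ∈ Icc a b, ∀ y ∈ Ω, f s y = f a y + ∫ r in a..s, f' r y := by
    intro s hs y hy
    have hss : Icc a s ⊆ Icc a b := Icc_subset_Icc_right hs.2
    rw [intervalIntegral.integral_eq_sub_of_hasDerivAt_of_le hs.1
      (f := fun r => f r y) (f' := fun r => f' r y)]
    · abel
    · exact fun r hr => ((hf r (hss hr) y hy).continuousWithinAt).mono hss
    · exact fun r hr => (hf r (hss (Ioo_subset_Icc_self hr)) y hy).hasDerivAt
        (Icc_mem_nhds hr.1 (hr.2.trans_le hs.2))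
    · exact ((hf'c y hy).mono (hsub s hs)).intervalIntegrable
  have key2 : ∀ s ∈ Icc a b,
      fderiv ℝ (f s) x = fderiv ℝ (f a) x + ∫ r in a..s, fderiv ℝ (f' r) x := by
    intro s hs
    have h1 : HasFDerivAt (fun y => ∫ r in a..s, f' r y) (∫ r in a..s, fderiv ℝ (f' r) x) x := by
      refine intervalIntegral.hasFDerivAt_integral_of_dominated_of_fderiv_le
        (F := fun y r => f' r y) (F' := fun y r => fderiv ℝ (f' r) y) (bound := fun _ => M) hΩ
        ?_ ?_ ?_ ?_ ?_ ?_
      · filter_upwards [hΩ] with y hy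
        exact ((hf'c y hy).mono (hsub' s hs)).aestronglyMeasurable measurableSet_uIoc
      · exact ((hf'c x hx).mono (hsub s hs)).intervalIntegrable
      · exact ((hDc x hx).mono (hsub' s hs)).aestronglyMeasurable measurableSet_uIoc
      · exact Eventually.of_forall fun r hr y hy => hM r (hsub' s hs hr) y hy
      · exact intervalIntegrable_const
      · exact Eventually.of_forall fun r hr y hy =>
          ((hf'd r (hsub' s hs hr)).differentiableAt (hopen.mem_nhds hy)).hasFDerivAt
    have h2 : HasFDerivAt (f a) (fderiv ℝ (f a) x) x :=
      ((hfd a ⟨le_rfl, hab⟩).differentiableAt hΩ).hasFDerivAt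
    refine HasFDerivAt.fderiv ((h2.add h1).congr_of_eventuallyEq ?_)
    filter_upwards [hΩ] with y hy using key s hs y hy
  -- Extending the integrand by constants beyond [a, b] makes it continuous on ℝ, so the two-sided
  -- fundamental theorem of calculus also serves at the end points.
  set G : ℝ → Space D →L[ℝ] F := IccExtend hab ((Icc a b).domRestrict fun r => fderiv ℝ (f' r) x)
    with hG
  have hGc : Continuous G := (hDc x hx).domRestrict.Icc_extend'
  have hGeq : ∀ r ∈ Icc a b, G r = fderiv ℝ (f' r) x := fun r hr => by
    rw [hG, IccExtend_of_mem hab _ hr]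
    rfl
  have key3 : ∀ s ∈ Icc a b, fderiv ℝ (f s) x = fderiv ℝ (f a) x + ∫ r in a..s, G r := by
    intro s hs
    rw [key2 s hs, intervalIntegral.integral_congr fun r hr => (hGeq r (hsub s hs hr)).symm]
  have hder : HasDerivAt (fun s => fderiv ℝ (f a) x + ∫ r in a..s, G r) (G t) t :=
    (intervalIntegral.integral_hasDerivAt_right (hGc.intervalIntegrable a t)
      (hGc.stronglyMeasurableAtFilter _ _) hGc.continuousAt).const_add _
  rw [← hGeq t ht]
  exact hder.hasDerivWithinAt.congr key3 (key3 t ht)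

/-! ### The cutoff φ_ε and its limit as ε → 0 -/

/-- A continuous cutoff of the real line: `0` for `|s| ≤ ε`, `1` for `|s| ≥ 2ε`. -/
def cutoffSlope (ε s : ℝ) : ℝ := max 0 (min 1 (|s| / ε - 1))

/-- A `C¹` approximation of the identity that vanishes for `|s| ≤ ε`. -/
def cutoff (ε s : ℝ) : ℝ := ∫ r in (0 : ℝ)..s, cutoffSlope ε r

theorem continuous_cutoffSlope (ε : ℝ) : Continuous (cutoffSlope ε) := by
  unfold cutoffSlope
  fun_prop

theorem cutoffSlope_nonneg (ε s : ℝ) : 0 ≤ cutoffSlope ε s := le_max_left _ _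

theorem cutoffSlope_le_one (ε s : ℝ) : cutoffSlope ε s ≤ 1 :=
  max_le zero_le_one (min_le_left _ _)

theorem cutoffSlope_eq_zero {ε s : ℝ} (hε : 0 < ε) (hs : |s| ≤ ε) : cutoffSlope ε s = 0 := by
  have : |s| / ε ≤ 1 := (div_le_one hε).2 hs
  exact max_eq_left ((min_le_right _ _).trans (by linarith))

theorem cutoffSlope_eq_one {ε s : ℝ} (hε : 0 < ε) (hs : 2 * ε ≤ |s|) : cutoffSlope ε s = 1 := by
  have : 2 ≤ |s| / ε := (le_div_iff₀ hε).2 hs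
  rw [cutoffSlope, min_eq_left (by linarith), max_eq_right zero_le_one]

theorem hasDerivAt_cutoff (ε s : ℝ) : HasDerivAt (cutoff ε) (cutoffSlope ε s) s :=
  intervalIntegral.integral_hasDerivAt_right
    ((continuous_cutoffSlope ε).intervalIntegrable _ _)
    ((continuous_cutoffSlope ε).stronglyMeasurableAtFilter _ _)
    (continuous_cutoffSlope ε).continuousAt

theorem contDiff_cutoff (ε : ℝ) : ContDiff ℝ 1 (cutoff ε) := by
  refine contDiff_one_iff_deriv.2 ⟨fun s => (hasDerivAt_cutoff ε s).differentiableAt, ?_⟩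
  rw [show deriv (cutoff ε) = cutoffSlope ε from funext fun s => (hasDerivAt_cutoff ε s).deriv]
  exact continuous_cutoffSlope ε

theorem cutoff_eq_zero {ε s : ℝ} (hε : 0 < ε) (hs : |s| ≤ ε) : cutoff ε s = 0 := by
  rw [cutoff, intervalIntegral.integral_congr (g := fun _ => (0 : ℝ))]
  · simp
  · intro r hr
    refine cutoffSlope_eq_zero hε (le_trans ?_ hs)
    simpa using abs_sub_left_of_mem_uIcc hr

theorem abs_cutoff_le (ε s : ℝ) : |cutoff ε s| ≤ |s| := by
  have := intervalIntegral.norm_integral_le_of_norm_le_const (a := 0) (b := s)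
    (f := cutoffSlope ε) (C := 1) fun r _ => by
      rw [Real.norm_of_nonneg (cutoffSlope_nonneg ε r)]
      exact cutoffSlope_le_one ε r
  simpa [cutoff] using this

theorem eventually_cutoffSlope_eq_one {s : ℝ} (hs : s ≠ 0) :
    ∀ᶠ ε in 𝓝[>] (0 : ℝ), cutoffSlope ε s = 1 := by
  have h : 0 < |s| / 2 := by positivity
  filter_upwards [Ioo_mem_nhdsGT h] with ε hε
  exact cutoffSlope_eq_one hε.1 (by linarith [hε.2])

theorem tendsto_cutoff (s : ℝ) : Tendsto (fun ε => cutoff ε s) (𝓝[>] 0) (𝓝 s) := by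
  have h : Tendsto (fun ε => ∫ r in (0 : ℝ)..s, cutoffSlope ε r) (𝓝[>] 0)
      (𝓝 (∫ _ in (0 : ℝ)..s, (1 : ℝ))) := by
    refine intervalIntegral.tendsto_integral_filter_of_dominated_convergence (fun _ => 1)
      (Eventually.of_forall fun ε => (continuous_cutoffSlope ε).aestronglyMeasurable)
      (Eventually.of_forall fun ε => Eventually.of_forall fun r _ => ?_)
      intervalIntegrable_const ?_
    · rw [Real.norm_of_nonneg (cutoffSlope_nonneg ε r)]
      exact cutoffSlope_le_one ε r
    -- The slopes tend to 1 except at r = 0, which is a null set.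
    · filter_upwards [Measure.ae_ne volume (0 : ℝ)] with r hr _
      exact tendsto_const_nhds.congr' ((eventually_cutoffSlope_eq_one hr).mono fun _ h => h.symm)
  simpa [cutoff] using h

/-! ### Extension by zero from an open set with arbitrary boundary -/

section ZeroBoundary

variable {D : ℕ} {Ω : Set (Space D)} {v : Space D → ℝ}

/-- At a point outside Ω, the limits along Ω and along its complement are both 0: the first by the
boundary condition (or vacuously, off the closure), the second trivially. -/
theorem continuous_indicator_of_hasBoundaryValue (hopen : IsOpen Ω) (hv : ContinuousOn v Ω)
    (hb : ∀ x ∈ frontier Ω, HasBoundaryValue Ω v x 0) : Continuous (Ω.indicator v) := by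
  refine continuous_iff_continuousAt.2 fun x => ?_
  by_cases hx : x ∈ Ω
  · refine (hv.continuousAt (hopen.mem_nhds hx)).congr ?_
    filter_upwards [hopen.mem_nhds hx] with y hy using (indicator_of_mem hy v).symm
  · have h0 : Ω.indicator v x = 0 := indicator_of_notMem hx v
    rw [ContinuousAt, h0]
    have hout : Tendsto (Ω.indicator v) (𝓝[Ωᶜ] x) (𝓝 0) :=
      tendsto_const_nhds.congr' <| by
        filter_upwards [self_mem_nhdsWithin] with y hy using (indicator_of_notMem hy v).symm
    have hin : Tendsto (Ω.indicator v) (𝓝[Ω] x) (𝓝 0) := by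
      have : Tendsto v (𝓝[Ω] x) (𝓝 0) := by
        by_cases hc : x ∈ closure Ω
        · exact hb x ⟨hc, fun h => hx (interior_subset h)⟩
        · rw [notMem_closure_iff_nhdsWithin_eq_bot.1 hc]
          exact tendsto_bot
      refine this.congr' ?_
      filter_upwards [self_mem_nhdsWithin] with y hy using (indicator_of_mem hy v).symm
    rw [← nhdsWithin_univ, ← union_compl_self Ω, nhdsWithin_union]
    exact hin.sup hout

variable (hopen : IsOpen Ω) (hbdd : Bornology.IsBounded Ω) (hv : ContinuousOn v Ω)
  (hb : ∀ x ∈ frontier Ω, HasBoundaryValue Ω v x 0) {ε : ℝ} (hε : 0 < ε)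

include hopen hbdd hv hb hε

/-- Since ε > 0, this is also a superlevel set of the zero extension of |v|, which is continuous on
the whole space. It is thus closed there, not merely in Ω. -/
theorem isCompact_setOf_le_abs : IsCompact {x | x ∈ Ω ∧ ε ≤ |v x|} := by
  have : {x | x ∈ Ω ∧ ε ≤ |v x|} = {x | ε ≤ |Ω.indicator v x|} := by
    ext x
    by_cases hx : x ∈ Ω <;> simp [hx, hε]
  refine Metric.isCompact_of_isClosed_isBounded ?_ (hbdd.subset fun x hx => hx.1)
  rw [this]
  exact isClosed_le continuous_const (continuous_indicator_of_hasBoundaryValue hopen hv hb).abs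

theorem hasCompactSupport_indicator {h : Space D → ℝ} (h0 : ∀ x ∈ Ω, |v x| < ε → h x = 0) :
    HasCompactSupport (Ω.indicator h) := by
  refine HasCompactSupport.intro (isCompact_setOf_le_abs hopen hbdd hv hb hε) fun x hx => ?_
  by_cases hΩ : x ∈ Ω
  · rw [indicator_of_mem hΩ]
    exact h0 x hΩ (not_le.1 fun hle => hx ⟨hΩ, hle⟩)
  · exact indicator_of_notMem hΩ h

/-- A point outside Ω has a neighbourhood disjoint from the compact set {|v| ≥ ε}; this is what
makes the zero extension smooth across ∂Ω. -/
theorem eventuallyEq_zero_indicator {h : Space D → ℝ} (h0 : ∀ x ∈ Ω, |v x| < ε → h x = 0)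
    {x : Space D} (hx : x ∉ Ω) : Ω.indicator h =ᶠ[𝓝 x] fun _ => 0 := by
  filter_upwards [(isCompact_setOf_le_abs hopen hbdd hv hb hε).isClosed.isOpen_compl.mem_nhds
    (show x ∈ {x | x ∈ Ω ∧ ε ≤ |v x|}ᶜ from fun h => hx h.1)] with y hy
  by_cases hΩ : y ∈ Ω
  · rw [indicator_of_mem hΩ]
    exact h0 y hΩ (not_le.1 fun hle => hy ⟨hΩ, hle⟩)
  · exact indicator_of_notMem hΩ h

theorem contDiff_indicator {n : ℕ} {h : Space D → ℝ} (hh : ContDiffOn ℝ n h Ω)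
    (h0 : ∀ x ∈ Ω, |v x| < ε → h x = 0) : ContDiff ℝ n (Ω.indicator h) := by
  refine contDiff_iff_contDiffAt.2 fun x => ?_
  by_cases hx : x ∈ Ω
  · refine (hh.contDiffAt (hopen.mem_nhds hx)).congr_of_eventuallyEq ?_
    filter_upwards [hopen.mem_nhds hx] with y hy using indicator_of_mem hy h
  · exact contDiffAt_const.congr_of_eventuallyEq
      (eventuallyEq_zero_indicator hopen hbdd hv hb hε h0 hx)

theorem fderiv_indicator {h : Space D → ℝ} (h0 : ∀ x ∈ Ω, |v x| < ε → h x = 0) (e : Space D) :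
    (fun x => fderiv ℝ (Ω.indicator h) x e) = Ω.indicator fun x => fderiv ℝ h x e := by
  funext x
  by_cases hx : x ∈ Ω
  · have : Ω.indicator h =ᶠ[𝓝 x] h := by
      filter_upwards [hopen.mem_nhds hx] with y hy using indicator_of_mem hy h
    rw [indicator_of_mem hx, this.fderiv_eq]
  · rw [indicator_of_notMem hx,
      (eventuallyEq_zero_indicator hopen hbdd hv hb hε h0 hx).fderiv_eq]
    simp

/-- The integral over `Ω` of a derivative of a `C¹` function whose support lies in a superlevel set
of `|v|` vanishes. -/
theorem setIntegral_fderiv_eq_zero {h : Space D → ℝ} (hh : ContDiffOn ℝ 1 h Ω)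
    (h0 : ∀ x ∈ Ω, |v x| < ε → h x = 0) (e : Space D) :
    IntegrableOn (fun x => fderiv ℝ h x e) Ω ∧ ∫ x in Ω, fderiv ℝ h x e = 0 := by
  have hH : ContDiff ℝ 1 (Ω.indicator h) :=
    contDiff_indicator (n := 1) hopen hbdd hv hb hε hh h0
  have hs := hasCompactSupport_indicator hopen hbdd hv hb hε h0
  have hi : Integrable (fun x => fderiv ℝ (Ω.indicator h) x e) :=
    ((hH.continuous_fderiv (by norm_num)).clm_apply continuous_const).integrable_of_hasCompactSupport
      (hs.fderiv_apply ℝ e)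
  -- Integration by parts against the constant 1.
  have hz := integral_mul_fderiv_eq_neg_fderiv_mul_of_integrable (μ := volume)
    (f := fun _ : Space D => (1 : ℝ)) (g := Ω.indicator h) (v := e) (by simp) (by simpa using hi)
    (by simpa using hH.continuous.integrable_of_hasCompactSupport hs)
    (fun x _ => differentiableAt_const _) fun x _ => hH.differentiable (by norm_num) x
  have heq := fderiv_indicator hopen hbdd hv hb hε h0 e
  constructor
  · rw [← integrable_indicator_iff hopen.measurableSet, ← heq]
    exact hi
  · rw [← integral_indicator hopen.measurableSet, ← heq]
    simpa using hz

end ZeroBoundary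

/-! ### Green's identity, the Poincaré inequality and differentiation under the integral -/

/-- The derivative of a function vanishes almost everywhere on its zero set. -/
theorem ae_fderiv_eq_zero_of_eq_zero {D : ℕ} {Ω : Set (Space D)} {v : Space D → ℝ}
    (hopen : IsOpen Ω) (hv : DifferentiableOn ℝ v Ω) :
    ∀ᵐ x ∂volume.restrict Ω, v x = 0 → fderiv ℝ v x = 0 := by
  have hms : MeasurableSet (Ω ∩ {x | v x = 0}) := by
    obtain ⟨U, hU, hUe⟩ := (continuousOn_iff_isClosed.1 hv.continuousOn) {0} isClosed_singleton
    rw [inter_comm]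
    change MeasurableSet (v ⁻¹' {0} ∩ Ω)
    rw [hUe]
    exact hU.measurableSet.inter hopen.measurableSet
  rcases subsingleton_or_nontrivial (Space D) with hsub | hnt
  · exact Eventually.of_forall fun x _ => by
      ext y
      rw [Subsingleton.elim y 0]
      simp
  obtain ⟨e, he⟩ := exists_ne (0 : Space D)
  -- `norm_fderiv_sub_le` concerns maps of a space to itself, so `v` is composed with the injection
  -- s ↦ s • e. On {v = 0} the composite is approximated by the zero map with constant 0, which
  -- forces its derivative to vanish there almost everywhere.
  set L : ℝ →L[ℝ] Space D := ContinuousLinearMap.toSpanSingleton ℝ e with hL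
  have happ : ApproximatesLinearOn (fun x => L (v x)) (0 : Space D →L[ℝ] Space D)
      (Ω ∩ {x | v x = 0}) 0 := by
    intro x hx y hy
    have h1 : v x = 0 := hx.2
    have h2 : v y = 0 := hy.2
    simp [h1, h2]
  have hae := happ.norm_fderiv_sub_le volume hms (fun x => L.comp (fderiv ℝ v x)) fun x hx =>
    (L.hasFDerivAt.comp x ((hv.differentiableAt (hopen.mem_nhds hx.1)).hasFDerivAt)).hasFDerivWithinAt
  rw [ae_restrict_iff' hms] at hae
  rw [ae_restrict_iff' hopen.measurableSet]
  filter_upwards [hae] with x hx hxΩ hx0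
  have h3 : L.comp (fderiv ℝ v x) = 0 := by
    have := hx ⟨hxΩ, hx0⟩
    simpa using this
  ext y
  have h4 : fderiv ℝ v x y • e = 0 := by
    have := congrArg (fun A => A y) h3
    simpa [hL] using this
  simpa [he] using h4

section Energy

variable {D : ℕ} {Ω : Set (Space D)} {v : Space D → ℝ}

theorem _root_.ContinuousOn.integrableOn_of_norm_le {f : Space D → ℝ}
    (hopen : IsOpen Ω) (hbdd : Bornology.IsBounded Ω) (hf : ContinuousOn f Ω)
    {M : ℝ} (hM : ∀ x ∈ Ω, ‖f x‖ ≤ M) : IntegrableOn f Ω :=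
  IntegrableOn.of_bound hbdd.measure_lt_top (hf.aestronglyMeasurable hopen.measurableSet) M
    ((ae_restrict_iff' hopen.measurableSet).2 (Eventually.of_forall hM))

/-- Green's identity for a function that vanishes on the boundary of an arbitrary bounded open
set. -/
theorem setIntegral_mul_laplacian (hopen : IsOpen Ω) (hbdd : Bornology.IsBounded Ω)
    (hv : ContDiffOn ℝ 2 v Ω) (hb : ∀ x ∈ frontier Ω, HasBoundaryValue Ω v x 0) {M : ℝ}
    (hM0 : ∀ x ∈ Ω, |v x| ≤ M) (hM1 : ∀ x ∈ Ω, ‖gradient v x‖ ≤ M)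
    (hM2 : ∀ x ∈ Ω, |Laplacian.laplacian v x| ≤ M) :
    ∫ x in Ω, v x * Laplacian.laplacian v x = -∫ x in Ω, ‖gradient v x‖ ^ 2 := by
  have hΔ : ContinuousOn (Laplacian.laplacian v) Ω := by
    refine (ContDiffOn.continuousOn (n := 0) (𝕜 := ℝ) ?_)
    refine ContDiffOn.congr (ContDiffOn.sum (s := Finset.univ) fun (j : Fin D) _ =>
      contDiffOn_fderiv_apply (m := 0) (n := 1) hopen (contDiffOn_fderiv_apply (m := 1) (n := 2)
        hopen hv (by norm_num) (EuclideanSpace.single j 1)) (by norm_num)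
        (EuclideanSpace.single j 1)) fun z hz => ?_
    exact laplacian_eq_sum (hv.contDiffAt (hopen.mem_nhds hz))
  have hg : ContinuousOn (gradient v) Ω := (contDiffOn_gradient hopen hv).continuousOn
  have hgi : IntegrableOn (fun x => ‖gradient v x‖ ^ 2) Ω := by
    refine (hg.norm.pow 2).integrableOn_of_norm_le hopen hbdd (M := M ^ 2) fun x hx => ?_
    rw [Real.norm_of_nonneg (by positivity)]
    exact pow_le_pow_left₀ (norm_nonneg _) (hM1 x hx) 2
  have hΔi : IntegrableOn (fun x => v x * Laplacian.laplacian v x) Ω := by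
    refine (hv.continuousOn.mul hΔ).integrableOn_of_norm_le hopen hbdd (M := M * M) fun x hx => ?_
    rw [norm_mul]
    exact mul_le_mul (hM0 x hx) (hM2 x hx) (abs_nonneg _) ((abs_nonneg _).trans (hM0 x hx))
  -- The integrand is the divergence of φ_ε(v)∇v, a C¹ field supported in {|v| ≥ ε}.
  have hzero : ∀ ε : ℝ, 0 < ε → ∫ x in Ω, (cutoff ε (v x) * Laplacian.laplacian v x +
      cutoffSlope ε (v x) * ‖gradient v x‖ ^ 2) = 0 := by
    intro ε hε
    have hj : ∀ j : Fin D, _ := fun j =>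
      setIntegral_fderiv_eq_zero hopen hbdd hv.continuousOn hb hε
      (h := fun x => cutoff ε (v x) * fderiv ℝ v x (EuclideanSpace.single j 1))
      (((contDiff_cutoff ε).comp_contDiffOn (hv.of_le (by norm_num))).mul
        (contDiffOn_fderiv_apply (m := 1) (n := 2) hopen hv (by norm_num) _))
      (fun x _ hx => by simp [cutoff_eq_zero hε hx.le]) (EuclideanSpace.single j 1)
    have hsum : ∫ x in Ω, ∑ j : Fin D, fderiv ℝ (fun x => cutoff ε (v x) *
        fderiv ℝ v x (EuclideanSpace.single j 1)) x (EuclideanSpace.single j 1) = 0 := by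
      rw [integral_finsetSum _ fun j _ => (hj j).1]
      exact Finset.sum_eq_zero fun j _ => (hj j).2
    rw [← hsum]
    refine setIntegral_congr_fun hopen.measurableSet fun x hx => ?_
    have hx2 := hv.contDiffAt (hopen.mem_nhds hx)
    have hc : HasFDerivAt (fun y => cutoff ε (v y)) (cutoffSlope ε (v x) • fderiv ℝ v x) x :=
      (hasDerivAt_cutoff ε (v x)).comp_hasFDerivAt x
        (hx2.differentiableAt (by norm_num)).hasFDerivAt
    simp only [norm_gradient_sq, laplacian_eq_sum hx2, Finset.mul_sum, ← Finset.sum_add_distrib]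
    refine Finset.sum_congr rfl fun j _ => ?_
    have hd : DifferentiableAt ℝ (fun y => fderiv ℝ v y (EuclideanSpace.single j 1)) x :=
      ((contDiffOn_fderiv_apply (m := 1) (n := 2) hopen hv (by norm_num) _).contDiffAt
        (hopen.mem_nhds hx)).differentiableAt (by norm_num)
    rw [(hc.fun_mul hd.hasFDerivAt).fderiv]
    simp only [add_apply, smul_apply, smul_eq_mul]
    ring
  have hlim : Tendsto (fun ε : ℝ => ∫ x in Ω, (cutoff ε (v x) * Laplacian.laplacian v x +
      cutoffSlope ε (v x) * ‖gradient v x‖ ^ 2)) (𝓝[>] 0)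
      (𝓝 (∫ x in Ω, (v x * Laplacian.laplacian v x + ‖gradient v x‖ ^ 2))) := by
    refine tendsto_integral_filter_of_dominated_convergence (fun _ => M * M + M ^ 2)
      (Eventually.of_forall fun ε => ?_) (Eventually.of_forall fun ε => ?_)
      (integrableOn_const hbdd.measure_lt_top.ne) ?_
    · refine ContinuousOn.aestronglyMeasurable ?_ hopen.measurableSet
      exact (((contDiff_cutoff ε).continuous.comp_continuousOn hv.continuousOn).mul hΔ).add
        (((continuous_cutoffSlope ε).comp_continuousOn hv.continuousOn).mul (hg.norm.pow 2))
    · refine (ae_restrict_iff' hopen.measurableSet).2 (Eventually.of_forall fun x hx => ?_)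
      refine (norm_add_le _ _).trans (add_le_add ?_ ?_)
      · rw [norm_mul]
        exact mul_le_mul ((abs_cutoff_le ε _).trans (hM0 x hx)) (hM2 x hx) (abs_nonneg _)
          ((abs_nonneg _).trans (hM0 x hx))
      · rw [norm_mul, Real.norm_of_nonneg (cutoffSlope_nonneg _ _),
          Real.norm_of_nonneg (by positivity)]
        exact (mul_le_of_le_one_left (by positivity) (cutoffSlope_le_one _ _)).trans
          (pow_le_pow_left₀ (norm_nonneg _) (hM1 x hx) 2)
    -- Where v ≠ 0, the slope φ_ε'(v) is eventually 1. Where v = 0 it is 0 for every ε > 0, and the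
    -- limit is still |∇v|² because ∇v = 0 almost everywhere there.
    · filter_upwards [ae_fderiv_eq_zero_of_eq_zero hopen (hv.differentiableOn (by norm_num))]
        with x hx
      refine ((tendsto_cutoff (v x)).mul_const _).add ?_
      rcases eq_or_ne (v x) 0 with h0 | h0
      · simp [norm_gradient, hx h0]
      · refine tendsto_const_nhds.congr' ?_
        filter_upwards [eventually_cutoffSlope_eq_one h0] with ε hε
        rw [hε, one_mul]
  have h0 : ∫ x in Ω, (v x * Laplacian.laplacian v x + ‖gradient v x‖ ^ 2) = 0 := by
    refine tendsto_nhds_unique hlim (tendsto_const_nhds.congr' ?_)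
    filter_upwards [self_mem_nhdsWithin] with ε hε using (hzero ε hε).symm
  rw [integral_add hΔi hgi] at h0
  linarith

/-- The Poincaré inequality for a function that vanishes on the boundary of an arbitrary bounded
open set. -/
theorem setIntegral_sq_le_gradient (hopen : IsOpen Ω) (i : Fin D) {R : ℝ}
    (hR : ∀ x ∈ Ω, ‖x‖ ≤ R) (hv : ContDiffOn ℝ 1 v Ω)
    (hb : ∀ x ∈ frontier Ω, HasBoundaryValue Ω v x 0) (hvi : IntegrableOn (fun x => v x ^ 2) Ω)
    (hgi : IntegrableOn (fun x => ‖gradient v x‖ ^ 2) Ω) :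
    ∫ x in Ω, v x ^ 2 ≤ 4 * R ^ 2 * ∫ x in Ω, ‖gradient v x‖ ^ 2 := by
  have hbdd : Bornology.IsBounded Ω := isBounded_iff_forall_norm_le.2 ⟨R, hR⟩
  have hcut : ∀ ε, AEStronglyMeasurable (fun x => cutoff ε (v x) ^ 2) (volume.restrict Ω) :=
    fun ε => (((contDiff_cutoff ε).continuous.comp_continuousOn hv.continuousOn).pow
      2).aestronglyMeasurable hopen.measurableSet
  have hsq : ∀ ε x, cutoff ε (v x) ^ 2 ≤ v x ^ 2 := fun ε x => sq_le_sq.2 (abs_cutoff_le ε _)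
  have hcuti : ∀ ε, IntegrableOn (fun x => cutoff ε (v x) ^ 2) Ω := fun ε =>
    hvi.mono' (hcut ε) (Eventually.of_forall fun x => by
      rw [Real.norm_of_nonneg (sq_nonneg _)]
      exact hsq ε x)
  have hle : ∀ ε : ℝ, 0 < ε →
      ∫ x in Ω, cutoff ε (v x) ^ 2 ≤ 4 * R ^ 2 * ∫ x in Ω, ‖gradient v x‖ ^ 2 := by
    intro ε hε
    have hproj : ContDiff ℝ 1 fun x : Space D => x i :=
      (EuclideanSpace.proj i : Space D →L[ℝ] ℝ).contDiff
    -- The identity ∫ ∂ᵢ(xᵢ φ_ε(v)²) = 0 is the source of the inequality.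
    obtain ⟨hi, hz⟩ := setIntegral_fderiv_eq_zero hopen hbdd hv.continuousOn hb hε
      (h := fun x => x i * cutoff ε (v x) ^ 2)
      (hproj.contDiffOn.mul (((contDiff_cutoff ε).comp_contDiffOn hv).pow 2))
      (fun x _ hx => by simp [cutoff_eq_zero hε hx.le]) (EuclideanSpace.single i 1)
    -- With φ = φ_ε(v) and b = xᵢ φ_ε'(v) ∂ᵢv, the derivative is φ² + 2φb. It is at least φ²/2 − 2b²
    -- because (φ + 2b)² ≥ 0, and |b| ≤ R|∇v|. Integrating gives the constant 4R².
    have hmono : ∫ x in Ω, (2⁻¹ * cutoff ε (v x) ^ 2 - 2 * R ^ 2 * ‖gradient v x‖ ^ 2) ≤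
        ∫ x in Ω, fderiv ℝ (fun x => x i * cutoff ε (v x) ^ 2) x (EuclideanSpace.single i 1) := by
      refine setIntegral_mono_on (((hcuti ε).const_mul _).sub (hgi.const_mul _)) hi
        hopen.measurableSet fun x hx => ?_
      have hc : HasFDerivAt (fun y => cutoff ε (v y)) (cutoffSlope ε (v x) • fderiv ℝ v x) x :=
        (hasDerivAt_cutoff ε (v x)).comp_hasFDerivAt x
          ((hv.contDiffAt (hopen.mem_nhds hx)).differentiableAt (by norm_num)).hasFDerivAt
      have hp : HasFDerivAt (fun y : Space D => y i) (EuclideanSpace.proj i : Space D →L[ℝ] ℝ) x :=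
        (EuclideanSpace.proj i : Space D →L[ℝ] ℝ).hasFDerivAt
      have hder : fderiv ℝ (fun x => x i * cutoff ε (v x) ^ 2) x (EuclideanSpace.single i 1) =
          cutoff ε (v x) ^ 2 + 2 * (cutoff ε (v x) * (x i * cutoffSlope ε (v x) *
            fderiv ℝ v x (EuclideanSpace.single i 1))) := by
        rw [(hp.fun_mul (hc.pow 2)).fderiv]
        simp
        ring
      rw [hder]
      have hb1 : |x i * cutoffSlope ε (v x) * fderiv ℝ v x (EuclideanSpace.single i 1)| ≤
          R * ‖gradient v x‖ := by
        rw [abs_mul, abs_mul, abs_of_nonneg (cutoffSlope_nonneg _ _), ← gradient_apply]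
        refine mul_le_mul ?_ (by simpa using PiLp.norm_apply_le (gradient v x) i) (abs_nonneg _)
          ((norm_nonneg _).trans (hR x hx))
        exact (mul_le_of_le_one_right (abs_nonneg _) (cutoffSlope_le_one _ _)).trans
          ((PiLp.norm_apply_le x i).trans (hR x hx))
      have hb2 := sq_le_sq' (abs_le.1 hb1).1 (abs_le.1 hb1).2
      nlinarith [sq_nonneg (cutoff ε (v x) + 2 * (x i * cutoffSlope ε (v x) *
            fderiv ℝ v x (EuclideanSpace.single i 1)))]
    rw [hz, integral_sub ((hcuti ε).const_mul _) (hgi.const_mul _), integral_const_mul,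
      integral_const_mul] at hmono
    linarith
  refine le_of_tendsto (x := 𝓝[>] (0 : ℝ)) (f := fun ε => ∫ x in Ω, cutoff ε (v x) ^ 2)
    (tendsto_integral_filter_of_dominated_convergence (fun x => v x ^ 2)
      (Eventually.of_forall hcut) (Eventually.of_forall fun ε => Eventually.of_forall fun x => ?_)
      hvi (Eventually.of_forall fun x => (tendsto_cutoff (v x)).pow 2)) ?_
  · rw [Real.norm_of_nonneg (sq_nonneg _)]
    exact hsq ε x
  · filter_upwards [self_mem_nhdsWithin] with ε hε using hle ε hε

/-- Differentiation under the integral sign, one-sided at the end points of the interval. -/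
theorem hasDerivWithinAt_setIntegral (hopen : IsOpen Ω) (hbdd : Bornology.IsBounded Ω)
    {a b : ℝ} {f f' : ℝ → Space D → ℝ} {M : ℝ}
    (hfi : ∀ s ∈ Icc a b, IntegrableOn (f s) Ω)
    (hf : ∀ s ∈ Icc a b, ∀ x ∈ Ω, HasDerivWithinAt (fun r => f r x) (f' s x) (Icc a b) s)
    (hM : ∀ s ∈ Icc a b, ∀ x ∈ Ω, |f' s x| ≤ M) {t : ℝ} (ht : t ∈ Icc a b) :
    HasDerivWithinAt (fun s => ∫ x in Ω, f s x) (∫ x in Ω, f' t x) (Icc a b) t := by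
  rw [hasDerivWithinAt_iff_tendsto_slope]
  have hslope : ∀ s ∈ Icc a b \ {t}, slope (fun s => ∫ x in Ω, f s x) t s =
      ∫ x in Ω, slope (fun r => f r x) t s := by
    intro s hs
    simp only [slope_def_field]
    rw [integral_div, integral_sub (hfi s hs.1) (hfi t ht)]
  refine Tendsto.congr' (f₁ := fun s => ∫ x in Ω, slope (fun r => f r x) t s) ?_ ?_
  · filter_upwards [self_mem_nhdsWithin] with s hs using (hslope s hs).symm
  refine tendsto_integral_filter_of_dominated_convergence (fun _ => M) ?_ ?_
    (integrableOn_const hbdd.measure_lt_top.ne) ?_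
  · filter_upwards [self_mem_nhdsWithin] with s hs
    simp only [slope_def_field]
    exact (((hfi s hs.1).sub (hfi t ht)).div_const _).aestronglyMeasurable
  · filter_upwards [self_mem_nhdsWithin] with s hs
    refine (ae_restrict_iff' hopen.measurableSet).2 (Eventually.of_forall fun x hx => ?_)
    -- By the mean value inequality on [a, b], `M` dominates the difference quotients, including the
    -- one-sided ones at the end points.
    have hmv := (convex_Icc a b).norm_image_sub_le_of_norm_hasDerivWithin_le
      (fun r hr => hf r hr x hx) (fun r hr => hM r hr x hx) ht hs.1
    have hst : 0 < ‖s - t‖ := norm_pos_iff.2 (sub_ne_zero.2 hs.2)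
    rw [slope_def_field, norm_div]
    exact (div_le_iff₀ hst).2 hmv
  · refine (ae_restrict_iff' hopen.measurableSet).2 (Eventually.of_forall fun x hx => ?_)
    exact hasDerivWithinAt_iff_tendsto_slope.1 (hf t ht x hx)

end Energy

/-! ### Bounds up to the boundary and compact time intervals -/

section Regularity

variable {D : ℕ} {F : Type*} [NormedAddCommGroup F] {J : Set ℝ} {Ω : Set (Space D)}

theorem ContinuousUpToBoundary.continuousOn_time {f : ℝ → Space D → F}
    (h : ContinuousUpToBoundary J Ω f) {x : Space D} (hx : x ∈ Ω) :
    ContinuousOn (fun s => f s x) J := by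
  obtain ⟨g, hg, hgf⟩ := h
  refine (hg.comp (Continuous.prodMk_left x).continuousOn
    fun s hs => ⟨hs, subset_closure hx⟩).congr fun s hs => (hgf s hs x hx).symm

/-- The extension is continuous on the compact set I × closure Ω. -/
theorem ContinuousUpToBoundary.exists_bound {f : ℝ → Space D → F}
    (h : ContinuousUpToBoundary J Ω f) (hbdd : Bornology.IsBounded Ω) {I : Set ℝ}
    (hI : IsCompact I) (hIJ : I ⊆ J) : ∃ M, ∀ s ∈ I, ∀ x ∈ Ω, ‖f s x‖ ≤ M := by
  obtain ⟨g, hg, hgf⟩ := h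
  obtain ⟨M, hM⟩ := (hI.prod hbdd.isCompact_closure).exists_bound_of_continuousOn
    (hg.mono (prod_mono_left hIJ))
  refine ⟨M, fun s hs x hx => ?_⟩
  rw [← hgf s (hIJ hs) x hx]
  exact hM (s, x) ⟨hs, subset_closure hx⟩

theorem ContinuousUpToBoundary.comp {G : Type*} [TopologicalSpace G] {f : ℝ → Space D → F}
    (h : ContinuousUpToBoundary J Ω f) {L : F → G} (hL : Continuous L) :
    ContinuousUpToBoundary J Ω fun t x => L (f t x) := by
  obtain ⟨g, hg, hgf⟩ := h
  exact ⟨fun p => L (g p), hL.comp_continuousOn hg, fun t ht x hx => congrArg L (hgf t ht x hx)⟩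

variable [NormedSpace ℝ F] {k : ℕ} {f : ℝ → Space D → F}

theorem SpatiallyC.continuousUpToBoundary (h : SpatiallyC k J Ω f) :
    ContinuousUpToBoundary J Ω f := by
  have := (h.2 0 (Nat.zero_le _)).comp
    (continuousMultilinearCurryFin0 ℝ (Space D) F).continuous
  exact this

theorem SpatiallyC.continuousUpToBoundary_fderiv (h : SpatiallyC k J Ω f) (hk : 1 ≤ k) :
    ContinuousUpToBoundary J Ω fun t x => fderiv ℝ (f t) x := by
  have := (h.2 1 hk).comp (continuousMultilinearCurryFin1 ℝ (Space D) F).continuous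
  have key : ∀ t x, continuousMultilinearCurryFin1 ℝ (Space D) F (iteratedFDeriv ℝ 1 (f t) x) =
      fderiv ℝ (f t) x := fun t x => by
    ext y
    simp
  simpa only [key] using this

end Regularity

section TimeInterval

/-- Uniform bounds hold only on compact time intervals. Since `b` lies strictly beyond `t`, a
derivative within [t₀, b] is also one within [t₀, T). -/
theorem exists_Icc_subset_timeInterval {t₀ : ℝ} {T : EReal} {t : ℝ}
    (ht : t ∈ timeInterval t₀ T) :
    ∃ b, t < b ∧ Icc t₀ b ⊆ timeInterval t₀ T ∧ Icc t₀ b ∈ 𝓝[timeInterval t₀ T] t := by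
  obtain ⟨b, hb1, hb2⟩ := EReal.lt_iff_exists_real_btwn.1 ht.2
  have hb1 : t < b := by exact_mod_cast hb1
  refine ⟨b, hb1, fun s hs => ⟨hs.1, lt_of_le_of_lt (by exact_mod_cast hs.2) hb2⟩, ?_⟩
  filter_upwards [self_mem_nhdsWithin, mem_nhdsWithin_of_mem_nhds (Iio_mem_nhds hb1)]
    with s hs hsb using ⟨hs.1, hsb.le⟩

theorem convex_timeInterval (t₀ : ℝ) (T : EReal) : Convex ℝ (timeInterval t₀ T) := by
  refine OrdConnected.convex ⟨fun x hx y hy z hz => ⟨hx.1.trans hz.1, ?_⟩⟩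
  exact lt_of_le_of_lt (by exact_mod_cast hz.2) hy.2

end TimeInterval

/-! ### Heat equation and energy identity for ∇·w -/

section Solution

variable {D : ℕ} {Ω : Set (Space D)} {J : Set ℝ} {ν lam : ℝ}
  {g w u : ℝ → Space D → Space D} {q : ℝ → Space D → ℝ}

theorem IsGePUPESolution.contDiffOn_divergence (hs : IsGePUPESolution Ω J ν lam g w u q)
    (hopen : IsOpen Ω) {t : ℝ} (ht : t ∈ J) : ContDiffOn ℝ 2 (divergence (w t)) Ω :=
  ContDiffOn.divergence (n := 3) (m := 2) hopen (hs.w_reg.1 t ht) (by norm_num)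

/-- The divergence of the momentum equation. -/
theorem IsGePUPESolution.divergence_timeDeriv (hs : IsGePUPESolution Ω J ν lam g w u q)
    (hopen : IsOpen Ω) {t : ℝ} (ht : t ∈ J) {x : Space D} (hx : x ∈ Ω) :
    divergence (timeDeriv J w t) x = ν * Laplacian.laplacian (divergence (w t)) x := by
  have hΩ : Ω ∈ 𝓝 x := hopen.mem_nhds hx
  have hd : ∀ {h : Space D → Space D}, ContDiffOn ℝ 1 h Ω → HasFDerivAt h (fderiv ℝ h x) x :=
    fun hh => ((hh.contDiffAt hΩ).differentiableAt (by norm_num)).hasFDerivAt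
  have hgc : ContDiffOn ℝ 1 (fun y => g t y - convection (u t) y) Ω :=
    (hs.g_reg t ht).sub (contDiffOn_convection hopen (hs.u_reg t ht))
  have hq := contDiffOn_gradient hopen (hs.q_reg t ht)
  have hw := contDiffOn_laplacian hopen (hs.w_reg.1 t ht)
  have hder := (((hd hgc).fun_sub (hd hq)).fun_add ((hd hw).fun_const_smul ν)).congr_of_eventuallyEq
    (f₁ := timeDeriv J w t) (by
      filter_upwards [hΩ] with y hy using hs.momentum t ht y hy)
  have hdiv : divergence (timeDeriv J w t) x =
      divergence (fun y => g t y - convection (u t) y) x - divergence (gradient (q t)) x +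
        ν * divergence (Laplacian.laplacian (w t)) x := by
    simp only [divergence_eq_divCLM, hder.fderiv, map_add, map_sub, map_smul, smul_eq_mul]
  -- The pressure equation cancels the first two terms and leaves the viscous one.
  rw [hdiv, divergence_gradient hopen (hs.q_reg t ht) hx, hs.pressure t ht x hx,
    divergence_laplacian hopen (hs.w_reg.1 t ht) hx]
  ring

theorem IsGePUPESolution.continuousUpToBoundary_divergence
    (hs : IsGePUPESolution Ω J ν lam g w u q) :
    ContinuousUpToBoundary J Ω fun t => divergence (w t) := by
  simp only [divergence_eq_divCLM]
  exact (hs.w_reg.continuousUpToBoundary_fderiv (by norm_num)).comp (divCLM D).continuous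

theorem IsGePUPESolution.continuousUpToBoundary_divergence_timeDeriv
    (hs : IsGePUPESolution Ω J ν lam g w u q) :
    ContinuousUpToBoundary J Ω fun t => divergence (timeDeriv J w t) := by
  simp only [divergence_eq_divCLM]
  exact (hs.w_time_reg.continuousUpToBoundary_fderiv le_rfl).comp (divCLM D).continuous

theorem IsGePUPESolution.hasDerivWithinAt_divergence
    (hs : IsGePUPESolution Ω J ν lam g w u q) (hopen : IsOpen Ω) (hbdd : Bornology.IsBounded Ω)
    {a b : ℝ} (hab : a ≤ b) (hJ : Icc a b ⊆ J) {t : ℝ} (ht : t ∈ Icc a b) {x : Space D}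
    (hx : x ∈ Ω) :
    HasDerivWithinAt (fun s => divergence (w s) x) (divergence (timeDeriv J w t) x)
      (Icc a b) t := by
  obtain ⟨M, hM⟩ := (hs.w_time_reg.continuousUpToBoundary_fderiv le_rfl).exists_bound hbdd isCompact_Icc hJ
  have := hasDerivWithinAt_fderiv hopen hab (f := w) (f' := timeDeriv J w)
    (fun s hsI y hy => ((hs.w_time y hy s (hJ hsI)).hasDerivWithinAt).mono hJ)
    (fun s hsI => (hs.w_reg.1 s (hJ hsI)).differentiableOn (by norm_num))
    (fun y hy => (hs.w_time_reg.continuousUpToBoundary.continuousOn_time hy).mono hJ)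
    (fun s hsI => (hs.w_time_reg.1 s (hJ hsI)).differentiableOn (by norm_num))
    (fun y hy => ((hs.w_time_reg.continuousUpToBoundary_fderiv le_rfl).continuousOn_time hy).mono hJ) hM hx ht
  simp only [divergence_eq_divCLM]
  exact (divCLM D).hasFDerivAt.comp_hasDerivWithinAt t this

/-- This turns the bound on the second derivatives of `w` up to the boundary into a bound on ∇(∇·w),
as Green's identity requires. -/
theorem norm_fderiv_divergence_le {v : Space D → Space D} (hopen : IsOpen Ω)
    (hv : ContDiffOn ℝ 3 v Ω) {x : Space D} (hx : x ∈ Ω) :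
    ‖fderiv ℝ (divergence v) x‖ ≤ ‖divCLM D‖ * ‖iteratedFDeriv ℝ 2 v x‖ := by
  have hd : DifferentiableAt ℝ (fderiv ℝ v) x :=
    ((hv.fderiv_of_isOpen hopen (m := 2) (by norm_num)).contDiffAt
      (hopen.mem_nhds hx)).differentiableAt (by norm_num)
  have h1 : fderiv ℝ (divergence v) x = (divCLM D).comp (fderiv ℝ (fderiv ℝ v) x) := by
    rw [divergence_eq_divCLM]
    exact ((divCLM D).hasFDerivAt.comp x hd.hasFDerivAt).fderiv
  have h2 : ‖fderiv ℝ (fderiv ℝ v) x‖ = ‖iteratedFDeriv ℝ 2 v x‖ := by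
    rw [← norm_iteratedFDeriv_fderiv, norm_iteratedFDeriv_one]
  rw [h1, ← h2]
  exact ContinuousLinearMap.opNorm_comp_le _ _

theorem l2Norm_sq {F : Type*} [NormedAddCommGroup F] (f : Space D → F) :
    l2Norm Ω f ^ 2 = ∫ x in Ω, ‖f x‖ ^ 2 :=
  Real.sq_sqrt (integral_nonneg fun _ => by positivity)

/-- The derivative of ∫ v² is ∫ 2v ∂v/∂t = 2ν ∫ v Δv by the heat equation, and Green's identity
turns this into −2ν ∫ |∇v|². -/
theorem IsGePUPESolution.energy_identity (hs : IsGePUPESolution Ω J ν lam g w u q)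
    (hopen : IsOpen Ω) (hbdd : Bornology.IsBounded Ω) (hν : 0 < ν) {a b : ℝ} (hab : a ≤ b)
    (hJ : Icc a b ⊆ J) {t : ℝ} (ht : t ∈ Icc a b) :
    IntegrableOn (fun x => ‖divergence (w t) x‖ ^ 2) Ω ∧
      IntegrableOn (fun x => ‖gradient (divergence (w t)) x‖ ^ 2) Ω ∧
      HasDerivWithinAt (fun s => l2Norm Ω (divergence (w s)) ^ 2)
        (-2 * ν * l2Norm Ω (gradient (divergence (w t))) ^ 2) (Icc a b) t := by
  obtain ⟨M0, hM0⟩ := hs.continuousUpToBoundary_divergence.exists_bound hbdd isCompact_Icc hJ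
  obtain ⟨M1, hM1⟩ := (hs.w_reg.2 2 (by norm_num)).exists_bound hbdd isCompact_Icc hJ
  obtain ⟨M2, hM2⟩ := hs.continuousUpToBoundary_divergence_timeDeriv.exists_bound hbdd
    isCompact_Icc hJ
  have hC2 : ∀ s ∈ Icc a b, ContDiffOn ℝ 2 (divergence (w s)) Ω := fun s hsI =>
    hs.contDiffOn_divergence hopen (hJ hsI)
  have hint : ∀ s ∈ Icc a b, IntegrableOn (fun x => ‖divergence (w s) x‖ ^ 2) Ω :=
    fun s hsI => ((hC2 s hsI).continuousOn.norm.pow 2).integrableOn_of_norm_le hopen hbdd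
      (M := M0 ^ 2) fun x hx => by
        rw [Real.norm_of_nonneg (by positivity)]
        exact pow_le_pow_left₀ (norm_nonneg _) (hM0 s hsI x hx) 2
  have hgrad : ∀ x ∈ Ω, ‖gradient (divergence (w t)) x‖ ≤ ‖divCLM D‖ * M1 := fun x hx => by
    rw [norm_gradient]
    exact (norm_fderiv_divergence_le hopen (hs.w_reg.1 t (hJ ht)) hx).trans
      (mul_le_mul_of_nonneg_left (hM1 t ht x hx) (divCLM D).opNorm_nonneg)
  refine ⟨hint t ht, ?_, ?_⟩
  · refine ((contDiffOn_gradient hopen (hC2 t ht)).continuousOn.norm.pow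
      2).integrableOn_of_norm_le hopen hbdd (M := (‖divCLM D‖ * M1) ^ 2) fun x hx => ?_
    rw [Real.norm_of_nonneg (by positivity)]
    exact pow_le_pow_left₀ (norm_nonneg _) (hgrad x hx) 2
  -- The bound is read off the heat equation: νΔ(∇·w) equals ∇·(∂w/∂t), which `M2` bounds.
  have hlap : ∀ x ∈ Ω, |Laplacian.laplacian (divergence (w t)) x| ≤ M2 / ν := fun x hx => by
    rw [le_div_iff₀ hν, mul_comm]
    have := hM2 t ht x hx
    rwa [hs.divergence_timeDeriv hopen (hJ ht) hx, norm_mul, Real.norm_of_nonneg hν.le] at this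
  have hgreen := setIntegral_mul_laplacian hopen hbdd (hC2 t ht)
    (hs.div_boundary t (hJ ht)) (M := max M0 (max (‖divCLM D‖ * M1) (M2 / ν)))
    (fun x hx => (hM0 t ht x hx).trans (le_max_left _ _))
    (fun x hx => (hgrad x hx).trans ((le_max_left _ _).trans (le_max_right _ _)))
    (fun x hx => (hlap x hx).trans ((le_max_right _ _).trans (le_max_right _ _)))
  have hder := hasDerivWithinAt_setIntegral hopen hbdd (f := fun s x => ‖divergence (w s) x‖ ^ 2)
    (f' := fun s x => 2 * divergence (w s) x * divergence (timeDeriv J w s) x)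
    (M := 2 * M0 * M2) hint
    (fun s hsI x hx => by
      simpa using (hs.hasDerivWithinAt_divergence hopen hbdd hab hJ hsI hx).fun_pow 2)
    (fun s hsI x hx => by
      rw [abs_mul, abs_mul, abs_two]
      have h0 := hM0 s hsI x hx
      exact mul_le_mul (mul_le_mul_of_nonneg_left h0 zero_le_two) (hM2 s hsI x hx)
        (abs_nonneg _) (mul_nonneg zero_le_two ((norm_nonneg _).trans h0))) ht
  simp only [l2Norm_sq]
  convert hder using 1
  have hcongr : ∫ x in Ω, 2 * divergence (w t) x * divergence (timeDeriv J w t) x =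
      ∫ x in Ω, 2 * ν * (divergence (w t) x * Laplacian.laplacian (divergence (w t)) x) := by
    refine setIntegral_congr_fun hopen.measurableSet fun x hx => ?_
    simp only [hs.divergence_timeDeriv hopen (hJ ht) hx]
    ring
  rw [hcongr, integral_const_mul, hgreen]
  ring

/-- The constant of the Poincaré inequality for divergences. -/
theorem exists_poincare_divergence (hopen : IsOpen Ω) (hbdd : Bornology.IsBounded Ω) :
    ∃ C : ℝ, 0 < C ∧ ∀ v : Space D → Space D, ContDiffOn ℝ 2 (divergence v) Ω →
      (∀ x ∈ frontier Ω, HasBoundaryValue Ω (divergence v) x 0) →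
      IntegrableOn (fun x => ‖divergence v x‖ ^ 2) Ω →
      IntegrableOn (fun x => ‖gradient (divergence v) x‖ ^ 2) Ω →
      C * l2Norm Ω (divergence v) ^ 2 ≤ l2Norm Ω (gradient (divergence v)) ^ 2 := by
  -- For D = 0 the divergence is an empty sum and any constant works. Otherwise the Poincaré
  -- inequality in one coordinate direction gives C = 1/(4R²), with `R` a bound for |x| on Ω.
  rcases Nat.eq_zero_or_pos D with rfl | hD
  · refine ⟨1, one_pos, fun v _ _ _ _ => ?_⟩
    have : divergence v = fun _ => 0 := by
      funext x
      simp [divergence]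
    rw [this, l2Norm_sq]
    simpa using sq_nonneg _
  · obtain ⟨R, hR0, hR⟩ := hbdd.exists_pos_norm_le
    refine ⟨(4 * R ^ 2)⁻¹, by positivity, fun v hv hb hi hgi => ?_⟩
    have := setIntegral_sq_le_gradient hopen ⟨0, hD⟩ hR (hv.of_le (by norm_num)) hb
      (by simpa using hi) hgi
    rw [l2Norm_sq, l2Norm_sq, inv_mul_le_iff₀ (by positivity)]
    simpa using this

end Solution

/-! ### Exponential decay -/

/-- Grönwall's inequality for a differential inequality `E' ≤ -c E`. -/
theorem le_exp_mul_of_hasDerivWithinAt {J : Set ℝ} (hJ : Convex ℝ J) {E E' : ℝ → ℝ} {c : ℝ}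
    (hE : ∀ t ∈ J, HasDerivWithinAt E (E' t) J t) (hle : ∀ t ∈ J, E' t ≤ -(c * E t))
    {s t : ℝ} (hs : s ∈ J) (ht : t ∈ J) (hst : s ≤ t) :
    E t ≤ Real.exp (-(c * (t - s))) * E s := by
  -- The integrating factor exp(cr) turns the differential inequality into monotonicity of exp(cr)
  -- E(r).
  have hd : ∀ r ∈ J, HasDerivWithinAt (fun r => Real.exp (c * r) * E r)
      (Real.exp (c * r) * (c * E r + E' r)) J r := by
    intro r hr
    have h1 : HasDerivWithinAt (fun r => Real.exp (c * r)) (Real.exp (c * r) * (c * 1)) J r :=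
      (((hasDerivAt_id r).const_mul c).exp).hasDerivWithinAt
    refine (h1.fun_mul (hE r hr)).congr_deriv ?_
    ring
  have hanti : AntitoneOn (fun r => Real.exp (c * r) * E r) J := by
    refine antitoneOn_of_hasDerivWithinAt_nonpos hJ (fun r hr => (hd r hr).continuousWithinAt)
      (fun r hr => (hd r (interior_subset hr)).mono interior_subset) fun r hr => ?_
    exact mul_nonpos_of_nonneg_of_nonpos (Real.exp_pos _).le
      (by linarith [hle r (interior_subset hr)])
  have h := hanti hs ht hst
  have hexp : Real.exp (-(c * (t - s))) = Real.exp (c * s) * (Real.exp (c * t))⁻¹ := by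
    rw [← Real.exp_neg, ← Real.exp_add]
    ring_nf
  rw [hexp, mul_right_comm, ← div_eq_mul_inv, le_div_iff₀ (Real.exp_pos _)]
  simpa [mul_comm] using h

end GePUP

end

/-! ### The main theorem -/

open GePUP in
theorem mainTheorem3 {D : ℕ} (Ω : Set (GePUP.Space D)) (hopen : IsOpen Ω)
    (hconn : IsConnected Ω) (hbdd : Bornology.IsBounded Ω) :
    ∃ C : ℝ, 0 < C ∧
      ∀ (ν lam t₀ : ℝ) (T : EReal), 0 < ν → 0 ≤ lam → (t₀ : EReal) < T →
      ∀ (g w u : ℝ → GePUP.Space D → GePUP.Space D) (q : ℝ → GePUP.Space D → ℝ),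
        GePUP.IsGePUPESolution Ω (GePUP.timeInterval t₀ T) ν lam g w u q →
        ∀ t ∈ GePUP.timeInterval t₀ T,
          -- the heat equation for the divergence of `w`, with homogeneous Dirichlet data
          (ContDiffOn ℝ 2 (GePUP.divergence (w t)) Ω ∧
            (∀ x ∈ Ω, HasDerivWithinAt (fun s => GePUP.divergence (w s) x)
              (ν * Laplacian.laplacian (GePUP.divergence (w t)) x)
              (GePUP.timeInterval t₀ T) t) ∧
            ∀ x ∈ frontier Ω, GePUP.HasBoundaryValue Ω (GePUP.divergence (w t)) x 0) ∧
          -- the energy identity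
          (MeasureTheory.IntegrableOn (fun x => ‖GePUP.divergence (w t) x‖ ^ 2) Ω ∧
            MeasureTheory.IntegrableOn
              (fun x => ‖gradient (GePUP.divergence (w t)) x‖ ^ 2) Ω ∧
            HasDerivWithinAt (fun s => GePUP.l2Norm Ω (GePUP.divergence (w s)) ^ 2)
              (-2 * ν * GePUP.l2Norm Ω (gradient (GePUP.divergence (w t))) ^ 2)
              (GePUP.timeInterval t₀ T) t) ∧
          -- the exponential decay
          GePUP.l2Norm Ω (GePUP.divergence (w t)) ≤
            Real.exp (-(ν * C * (t - t₀))) * GePUP.l2Norm Ω (GePUP.divergence (w t₀)) := by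
  obtain ⟨C, hC, hpoin⟩ := exists_poincare_divergence hopen hbdd
  refine ⟨C, hC, ?_⟩
  intro ν lam t₀ T hν _ _ g w u q hs
  have hmain : ∀ t ∈ timeInterval t₀ T,
      IntegrableOn (fun x => ‖divergence (w t) x‖ ^ 2) Ω ∧
        IntegrableOn (fun x => ‖gradient (divergence (w t)) x‖ ^ 2) Ω ∧
        HasDerivWithinAt (fun s => l2Norm Ω (divergence (w s)) ^ 2)
          (-2 * ν * l2Norm Ω (gradient (divergence (w t))) ^ 2) (timeInterval t₀ T) t := by
    intro t ht
    obtain ⟨b, htb, hbJ, hbn⟩ := exists_Icc_subset_timeInterval ht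
    obtain ⟨h1, h2, h3⟩ := hs.energy_identity hopen hbdd hν (ht.1.trans htb.le) hbJ
      ⟨ht.1, htb.le⟩
    exact ⟨h1, h2, h3.mono_of_mem_nhdsWithin hbn⟩
  intro t ht
  refine ⟨⟨hs.contDiffOn_divergence hopen ht, fun x hx => ?_, hs.div_boundary t ht⟩,
    hmain t ht, ?_⟩
  · obtain ⟨b, htb, hbJ, hbn⟩ := exists_Icc_subset_timeInterval ht
    rw [← hs.divergence_timeDeriv hopen ht hx]
    exact (hs.hasDerivWithinAt_divergence hopen hbdd (ht.1.trans htb.le) hbJ ⟨ht.1, htb.le⟩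
      hx).mono_of_mem_nhdsWithin hbn
  -- Grönwall is applied to the squared norm with rate 2νC: the 2ν comes from the energy identity
  -- and the C from Poincaré. Taking square roots halves the rate to νC.
  · have ht0 : t₀ ∈ timeInterval t₀ T :=
      ⟨le_rfl, lt_of_le_of_lt (by exact_mod_cast ht.1) ht.2⟩
    have hdecay := le_exp_mul_of_hasDerivWithinAt (convex_timeInterval t₀ T) (c := 2 * (ν * C))
      (fun s hsJ => (hmain s hsJ).2.2) (fun s hsJ => by
        have := mul_le_mul_of_nonneg_left (hpoin (w s) (hs.contDiffOn_divergence hopen hsJ)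
          (hs.div_boundary s hsJ) (hmain s hsJ).1 (hmain s hsJ).2.1) (mul_nonneg zero_le_two hν.le)
        linarith) ht0 ht ht.1
    refine (sq_le_sq₀ (Real.sqrt_nonneg _)
      (mul_nonneg (Real.exp_pos _).le (Real.sqrt_nonneg _))).1 ?_
    rw [mul_pow, ← Real.exp_nat_mul, show ((2 : ℕ) : ℝ) * -(ν * C * (t - t₀)) =
      -(2 * (ν * C) * (t - t₀)) by push_cast; ring]
    exact hdecay
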